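/- Let $0\le k\le n$ be integers and let $$\mathrm{Gr}(k,n)=\{Q\in\mathrm O(n): Q^{\mathsf T}=Q,\ \operatorname{tr}(Q)=2k-n\},$$ regarded as a submanifold of $\mathbb R^{n\times n}$ with the Riemannian metric $\langle X,Y\rangle_Q=\operatorname{tr}(XY)$ on $T_Q\mathrm{Gr}(k,n)$ that it inherits from the Euclidean inner product $\operatorname{tr}(X^{\mathsf T}Y)$; the covariant derivative of a tangent vector field along a curve is the orthogonal projection of its ordinary derivative onto the tangent space. Write $I_{k,n-k}=\operatorname{diag}(I_k,-I_{n-k})$. Let $V\in\mathrm O(n)$, let $B,C\in\mathbb R^{k\times(n-k)}$, and put $$Q=V I_{k,n-k}V^{\mathsf T},\qquad X=V\begin{bmatrix}0&B\\B^{\mathsf T}&0\end{bmatrix}V^{\mathsf T},\qquad Y=V\begin{bmatrix}0&C\\C^{\mathsf T}&0\end{bmatrix}V^{\mathsf T}.$$ There is a geodesic of $\mathrm{Gr}(k,n)$ defined on all of $\mathbb R$ with $\gamma(0)=Q$ and $\dot\gamma(0)=X$. Let $\gamma$ be any geodesic of $\mathrm{Gr}(k,n)$ on an open interval $J\ni 0$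 with $\gamma(0)=Q$ and $\dot\gamma(0)=X$. Then there is exactly one parallel tangent vector field $Y(t)$, $t\in J$, along $\gamma$ with $Y(0)=Y$ (the parallel transport of $Y$ along $\gamma$), namely $$Y(t)=V\exp\left(\frac t2\begin{bmatrix}0&-B\\B^{\mathsf T}&0\end{bmatrix}\right)\begin{bmatrix}0&C\\C^{\mathsf T}&0\end{bmatrix}\exp\left(\frac t2\begin{bmatrix}0&B\\-B^{\mathsf T}&0\end{bmatrix}\right)V^{\mathsf T}.$$ That is, the block $C$ stays constant: for every $t\in J$ the matrix $V(t)=V\exp\left(\frac t2\begin{bmatrix}0&-B\\B^{\mathsf T}&0\end{bmatrix}\right)$ is orthogonal, $\gamma(t)=V(t)I_{k,n-k}V(t)^{\mathsf T}$, and $Y(t)=V(t)\begin{bmatrix}0&C\\C^{\mathsf T}&0\end{bmatrix}V(t)^{\mathsf T}$. -/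

import Mathlib

open scoped Matrix ContDiff

noncomputable section

namespace InvolutionModel

/-- The `n × n` block matrix `[[A₁₁, A₁₂], [A₂₁, A₂₂]]` whose first block row and first block
column have size `k` and whose second ones have size `n - k`. -/
def block {n k : ℕ} (hk : k ≤ n)
    (A₁₁ : Matrix (Fin k) (Fin k) ℝ) (A₁₂ : Matrix (Fin k) (Fin (n - k)) ℝ)
    (A₂₁ : Matrix (Fin (n - k)) (Fin k) ℝ) (A₂₂ : Matrix (Fin (n - k)) (Fin (n - k)) ℝ) :
    Matrix (Fin n) (Fin n) ℝ :=
  Matrix.reindex (finSumFinEquiv.trans (finCongr (Nat.add_sub_of_le hk)))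
    (finSumFinEquiv.trans (finCongr (Nat.add_sub_of_le hk)))
    (Matrix.fromBlocks A₁₁ A₁₂ A₂₁ A₂₂)

/-- The signature matrix `I_{k,n-k} = diag(I_k, -I_{n-k})`. -/
def signature {n k : ℕ} (hk : k ≤ n) : Matrix (Fin n) (Fin n) ℝ :=
  block hk 1 0 0 (-1)

/-- The involution model of the Grassmannian `Gr(k, n)`: symmetric orthogonal `n × n` matrices
of trace `2k - n`. -/
def Gr (k n : ℕ) : Set (Matrix (Fin n) (Fin n) ℝ) :=
  {Q | Q ∈ Matrix.orthogonalGroup (Fin n) ℝ ∧ Qᵀ = Q ∧ Q.trace = 2 * (k : ℝ) - (n : ℝ)}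

/-- The tangent space of `Gr(k, n)`, as a submanifold of `ℝ^{n × n}`, at `Q`: the velocities at
`Q` of the smooth curves (all entries are smooth) in `Gr(k, n)` through `Q`. -/
def tangentSpace (k : ℕ) {n : ℕ} (Q : Matrix (Fin n) (Fin n) ℝ) :
    Set (Matrix (Fin n) (Fin n) ℝ) :=
  {X | ∃ (ε : ℝ) (c : ℝ → Matrix (Fin n) (Fin n) ℝ), 0 < ε ∧
    (∀ t ∈ Set.Ioo (-ε) ε, c t ∈ Gr k n) ∧
    (∀ i j, ContDiffOn ℝ ∞ (fun t => c t i j) (Set.Ioo (-ε) ε)) ∧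
    c 0 = Q ∧ HasDerivAt c X 0}

/-- The inner product `tr(XᵀY)` of `ℝ^{n × n}`. On tangent vectors of `Gr(k, n)`, which are
symmetric, it is the Riemannian metric `⟨X, Y⟩ = tr(XY)`. -/
def metric {n : ℕ} (X Y : Matrix (Fin n) (Fin n) ℝ) : ℝ :=
  (Xᵀ * Y).trace

/-- `D` is the (Levi-Civita) covariant derivative at time `t` of the vector field `Z` along the
curve `γ` in `Gr(k, n)`. As the metric is inherited from the Euclidean space `ℝ^{n × n}`, this is
the orthogonal projection of the derivative of `Z` at `t` onto the tangent space at `γ t`. -/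
def HasCovDerivAt (k : ℕ) {n : ℕ} (γ Z : ℝ → Matrix (Fin n) (Fin n) ℝ)
    (D : Matrix (Fin n) (Fin n) ℝ) (t : ℝ) : Prop :=
  ∃ W, HasDerivAt Z W t ∧ D ∈ tangentSpace k (γ t) ∧
    ∀ T ∈ tangentSpace k (γ t), metric T (W - D) = 0

/-- `γ` is a geodesic of `Gr(k, n)` on the (open) interval `J`: a twice differentiable curve in
`Gr(k, n)` whose velocity has covariant derivative zero. -/
structure IsGeodesicOn (k : ℕ) {n : ℕ} (γ : ℝ → Matrix (Fin n) (Fin n) ℝ) (J : Set ℝ) :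
    Prop where
  mem : ∀ t ∈ J, γ t ∈ Gr k n
  differentiableAt : ∀ t ∈ J, DifferentiableAt ℝ γ t
  covDeriv : ∀ t ∈ J, HasCovDerivAt k γ (deriv γ) 0 t

/-- `γ` is a geodesic on the interval `J` emanating from `Q` in the direction `X`. -/
structure IsGeodesicFrom (k : ℕ) {n : ℕ} (γ : ℝ → Matrix (Fin n) (Fin n) ℝ) (J : Set ℝ)
    (Q X : Matrix (Fin n) (Fin n) ℝ) : Prop where
  isGeodesicOn : IsGeodesicOn k γ J
  start : γ 0 = Q
  velocity : HasDerivAt γ X 0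

/-- `Z` is the parallel transport of `Y` along the curve `γ` on the interval `J`: a tangent
vector field along `γ` with covariant derivative zero and `Z 0 = Y`. -/
structure IsParallelTransport (k : ℕ) {n : ℕ} (γ : ℝ → Matrix (Fin n) (Fin n) ℝ) (J : Set ℝ)
    (Y : Matrix (Fin n) (Fin n) ℝ) (Z : ℝ → Matrix (Fin n) (Fin n) ℝ) : Prop where
  tangent : ∀ t ∈ J, Z t ∈ tangentSpace k (γ t)
  covDeriv : ∀ t ∈ J, HasCovDerivAt k γ Z 0 t
  start : Z 0 = Y

end InvolutionModel

end

noncomputable section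
namespace InvolutionModel
variable {n : ℕ}
-- Tangent vectors at `Q` are the symmetric matrices anticommuting with `Q`
-- (`mem_tangentSpace_iff`); symmetric normal vectors commute with `Q`. Let `Ω` be skew and
-- anticommute with the signature `S`, and let `U = V exp(tΩ)`. Then `U M Uᵀ` has derivative `U (ΩM
-- - MΩ) Uᵀ`. If `M` is symmetric and anticommutes with `S`, the bracket commutes with `S`, so this
-- derivative is normal and `U M Uᵀ` is parallel along `U S Uᵀ`. Taking `M = ΩS - SΩ` shows that `U
-- S Uᵀ` is itself a geodesic.
--
-- Uniqueness is an energy argument (`eq_zero_of_metric_deriv_eq_zero`): the difference of two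
-- solutions is orthogonal to its own derivative. For geodesics, the conserved quantity `γ' γ = X Q`
-- first reduces the equation to the linear one `γ' = X Q γ` with `X Q` skew.
-- Calculus of matrix-valued curves
-- Derivatives depend only on the topology, so a norm can be chosen locally; the operator norm is
-- submultiplicative, as the product rule requires.
theorem hasDerivAt_mul {F G : ℝ → Matrix (Fin n) (Fin n) ℝ} {F' G' : Matrix (Fin n) (Fin n) ℝ}
    {t : ℝ} (hF : HasDerivAt F F' t) (hG : HasDerivAt G G' t) :
    HasDerivAt (fun s => F s * G s) (F' * G t + F t * G') t := by
  let _ : NormedRing (Matrix (Fin n) (Fin n) ℝ) := Matrix.linftyOpNormedRing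
  let _ : NormedAlgebra ℝ (Matrix (Fin n) (Fin n) ℝ) := Matrix.linftyOpNormedAlgebra
  exact HasDerivAt.mul (𝔸 := Matrix (Fin n) (Fin n) ℝ) hF hG

theorem hasDerivAt_transpose {F : ℝ → Matrix (Fin n) (Fin n) ℝ} {F' : Matrix (Fin n) (Fin n) ℝ}
    {t : ℝ} (hF : HasDerivAt F F' t) :
    HasDerivAt (fun s => (F s)ᵀ) F'ᵀ t := by
  let _ : NormedAddCommGroup (Matrix (Fin n) (Fin n) ℝ) := Matrix.normedAddCommGroup
  let _ : NormedSpace ℝ (Matrix (Fin n) (Fin n) ℝ) := Matrix.normedSpace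
  exact hasDerivAt_pi.2 fun i => hasDerivAt_pi.2 fun j => hasDerivAt_pi.1 (hasDerivAt_pi.1 hF j) i

theorem hasDerivAt_exp_smul (Ω : Matrix (Fin n) (Fin n) ℝ) (t : ℝ) :
    HasDerivAt (fun s : ℝ => NormedSpace.exp (s • Ω)) (NormedSpace.exp (t • Ω) * Ω) t := by
  let _ : NormedRing (Matrix (Fin n) (Fin n) ℝ) := Matrix.linftyOpNormedRing
  let _ : NormedAlgebra ℝ (Matrix (Fin n) (Fin n) ℝ) := Matrix.linftyOpNormedAlgebra
  exact hasDerivAt_exp_smul_const (𝕂 := ℝ) (𝔸 := Matrix (Fin n) (Fin n) ℝ) Ω t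

theorem contDiff_exp_smul (Ω : Matrix (Fin n) (Fin n) ℝ) (i j : Fin n) :
    ContDiff ℝ ∞ (fun s : ℝ => NormedSpace.exp (s • Ω) i j) := by
  let _ : NormedRing (Matrix (Fin n) (Fin n) ℝ) := Matrix.linftyOpNormedRing
  let _ : NormedAlgebra ℝ (Matrix (Fin n) (Fin n) ℝ) := Matrix.linftyOpNormedAlgebra
  have h : ContDiff ℝ ∞ (NormedSpace.exp : Matrix (Fin n) (Fin n) ℝ → _) :=
    contDiff_iff_contDiffAt.2 fun x => (NormedSpace.exp_analytic (𝕂 := ℝ) x).contDiffAt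
  exact (LinearMap.toContinuousLinearMap (Matrix.entryLinearMap ℝ ℝ i j)).contDiff.comp
    (h.comp (contDiff_id.smul contDiff_const))

theorem hasDerivAt_unique {F : ℝ → Matrix (Fin n) (Fin n) ℝ} {W W' : Matrix (Fin n) (Fin n) ℝ}
    {t : ℝ} (h : HasDerivAt F W t) (h' : HasDerivAt F W' t) : W = W' := by
  let _ : NormedAddCommGroup (Matrix (Fin n) (Fin n) ℝ) := Matrix.normedAddCommGroup
  let _ : NormedSpace ℝ (Matrix (Fin n) (Fin n) ℝ) := Matrix.normedSpace
  exact HasDerivAt.unique h h'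

theorem hasDerivAt_congr {F G : ℝ → Matrix (Fin n) (Fin n) ℝ} {W : Matrix (Fin n) (Fin n) ℝ}
    {J : Set ℝ} {t : ℝ} (hJ : IsOpen J) (ht : t ∈ J) (h : HasDerivAt F W t)
    (hFG : ∀ s ∈ J, G s = F s) : HasDerivAt G W t := by
  let _ : NormedAddCommGroup (Matrix (Fin n) (Fin n) ℝ) := Matrix.normedAddCommGroup
  let _ : NormedSpace ℝ (Matrix (Fin n) (Fin n) ℝ) := Matrix.normedSpace
  exact HasDerivAt.congr_of_eventuallyEq h (Filter.eventually_of_mem (hJ.mem_nhds ht) hFG)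

theorem hasDerivAt_const_matrix (M : Matrix (Fin n) (Fin n) ℝ) (t : ℝ) :
    HasDerivAt (fun _ : ℝ => M) 0 t := by
  let _ : NormedAddCommGroup (Matrix (Fin n) (Fin n) ℝ) := Matrix.normedAddCommGroup
  let _ : NormedSpace ℝ (Matrix (Fin n) (Fin n) ℝ) := Matrix.normedSpace
  exact hasDerivAt_const t M

theorem hasDerivAt_add {F G : ℝ → Matrix (Fin n) (Fin n) ℝ} {F' G' : Matrix (Fin n) (Fin n) ℝ}
    {t : ℝ} (hF : HasDerivAt F F' t) (hG : HasDerivAt G G' t) :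
    HasDerivAt (fun s => F s + G s) (F' + G') t := by
  let _ : NormedAddCommGroup (Matrix (Fin n) (Fin n) ℝ) := Matrix.normedAddCommGroup
  let _ : NormedSpace ℝ (Matrix (Fin n) (Fin n) ℝ) := Matrix.normedSpace
  exact HasDerivAt.add hF hG

theorem hasDerivAt_sub {F G : ℝ → Matrix (Fin n) (Fin n) ℝ} {F' G' : Matrix (Fin n) (Fin n) ℝ}
    {t : ℝ} (hF : HasDerivAt F F' t) (hG : HasDerivAt G G' t) :
    HasDerivAt (fun s => F s - G s) (F' - G') t := by
  let _ : NormedAddCommGroup (Matrix (Fin n) (Fin n) ℝ) := Matrix.normedAddCommGroup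
  let _ : NormedSpace ℝ (Matrix (Fin n) (Fin n) ℝ) := Matrix.normedSpace
  exact HasDerivAt.sub hF hG

theorem hasDerivAt_deriv {F : ℝ → Matrix (Fin n) (Fin n) ℝ} {t : ℝ}
    (h : DifferentiableAt ℝ F t) : HasDerivAt F (deriv F t) t := by
  let _ : NormedAddCommGroup (Matrix (Fin n) (Fin n) ℝ) := Matrix.normedAddCommGroup
  let _ : NormedSpace ℝ (Matrix (Fin n) (Fin n) ℝ) := Matrix.normedSpace
  exact DifferentiableAt.hasDerivAt h

theorem differentiableAt_of_hasDerivAt {F : ℝ → Matrix (Fin n) (Fin n) ℝ}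
    {W : Matrix (Fin n) (Fin n) ℝ} {t : ℝ} (h : HasDerivAt F W t) : DifferentiableAt ℝ F t := by
  let _ : NormedAddCommGroup (Matrix (Fin n) (Fin n) ℝ) := Matrix.normedAddCommGroup
  let _ : NormedSpace ℝ (Matrix (Fin n) (Fin n) ℝ) := Matrix.normedSpace
  exact HasDerivAt.differentiableAt h

theorem hasDerivAt_trace {F : ℝ → Matrix (Fin n) (Fin n) ℝ} {F' : Matrix (Fin n) (Fin n) ℝ}
    {t : ℝ} (hF : HasDerivAt F F' t) :
    HasDerivAt (fun s => (F s).trace) F'.trace t := by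
  let _ : NormedAddCommGroup (Matrix (Fin n) (Fin n) ℝ) := Matrix.normedAddCommGroup
  let _ : NormedSpace ℝ (Matrix (Fin n) (Fin n) ℝ) := Matrix.normedSpace
  simp only [Matrix.trace, Matrix.diag]
  exact HasDerivAt.fun_sum fun i _ => hasDerivAt_pi.1 (hasDerivAt_pi.1 hF i) i

/-! ### The Euclidean inner product and the energy argument -/

theorem metric_comm (X Y : Matrix (Fin n) (Fin n) ℝ) : metric X Y = metric Y X := by
  rw [metric, ← Matrix.trace_transpose, Matrix.transpose_mul, Matrix.transpose_transpose, metric]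

theorem metric_self_eq_zero {X : Matrix (Fin n) (Fin n) ℝ} (h : metric X X = 0) : X = 0 := by
  have := Matrix.trace_conjTranspose_mul_self_eq_zero_iff (A := X)
  exact this.1 (by simpa [metric, Matrix.conjTranspose_eq_transpose_of_trivial] using h)

/-- The squared norm of `D` has derivative `2⟨D, D'⟩ = 0`, hence is constant on the interval `J` and
equal to its value at `0`. -/
theorem eq_zero_of_metric_deriv_eq_zero {J : Set ℝ} (hJ : IsOpen J) (hc : J.OrdConnected)
    (h0 : (0 : ℝ) ∈ J) {D D' : ℝ → Matrix (Fin n) (Fin n) ℝ}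
    (hD : ∀ t ∈ J, HasDerivAt D (D' t) t) (hm : ∀ t ∈ J, metric (D t) (D' t) = 0)
    (hz : D 0 = 0) : ∀ t ∈ J, D t = 0 := by
  have hd : ∀ t ∈ J, HasDerivAt (fun s => metric (D s) (D s)) 0 t := by
    intro t ht
    have h := hasDerivAt_trace (hasDerivAt_mul (hasDerivAt_transpose (hD t ht)) (hD t ht))
    have e : ((D' t)ᵀ * D t + (D t)ᵀ * D' t).trace = 0 := by
      have h1 := hm t ht
      have h2 := metric_comm (D t) (D' t)
      rw [Matrix.trace_add]
      simp only [metric] at h1 h2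
      linarith
    rw [e] at h
    exact h
  intro t ht
  apply metric_self_eq_zero
  have := hJ.is_const_of_deriv_eq_zero hc.isPreconnected
    (fun t ht => (hd t ht).differentiableAt.differentiableWithinAt)
    (fun t ht => (hd t ht).deriv) ht h0
  simpa [hz, metric] using this

theorem eq_zero_of_hasDerivAt_zero {J : Set ℝ} (hJ : IsOpen J) (hc : J.OrdConnected)
    (h0 : (0 : ℝ) ∈ J) {D : ℝ → Matrix (Fin n) (Fin n) ℝ}
    (hD : ∀ t ∈ J, HasDerivAt D 0 t) (hz : D 0 = 0) : ∀ t ∈ J, D t = 0 :=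
  eq_zero_of_metric_deriv_eq_zero hJ hc h0 (D' := fun _ => 0) hD (by simp [metric]) hz

/-! ### Orthogonal conjugation and moving frames -/

variable {k : ℕ}

theorem mul_self_of_mem_Gr {Q : Matrix (Fin n) (Fin n) ℝ} (hQ : Q ∈ Gr k n) : Q * Q = 1 := by
  have h := (Matrix.mem_orthogonalGroup_iff (Fin n) ℝ).1 hQ.1
  rwa [hQ.2.1] at h

theorem mul_transpose_of_mem {U : Matrix (Fin n) (Fin n) ℝ}
    (hU : U ∈ Matrix.orthogonalGroup (Fin n) ℝ) : U * Uᵀ = 1 :=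
  (Matrix.mem_orthogonalGroup_iff (Fin n) ℝ).1 hU

theorem transpose_mul_of_mem {U : Matrix (Fin n) (Fin n) ℝ}
    (hU : U ∈ Matrix.orthogonalGroup (Fin n) ℝ) : Uᵀ * U = 1 :=
  (Matrix.mem_orthogonalGroup_iff' (Fin n) ℝ).1 hU

theorem conj_mul_conj {U : Matrix (Fin n) (Fin n) ℝ}
    (hU : U ∈ Matrix.orthogonalGroup (Fin n) ℝ) (M N : Matrix (Fin n) (Fin n) ℝ) :
    (U * M * Uᵀ) * (U * N * Uᵀ) = U * (M * N) * Uᵀ := by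
  calc _ = U * M * (Uᵀ * U) * N * Uᵀ := by simp only [mul_assoc]
    _ = _ := by rw [transpose_mul_of_mem hU]; simp only [mul_assoc, one_mul]

theorem conj_mem_Gr {U S : Matrix (Fin n) (Fin n) ℝ}
    (hU : U ∈ Matrix.orthogonalGroup (Fin n) ℝ) (hS : S ∈ Gr k n) : U * S * Uᵀ ∈ Gr k n := by
  have ht : (U * S * Uᵀ)ᵀ = U * S * Uᵀ := by
    simp only [Matrix.transpose_mul, Matrix.transpose_transpose, hS.2.1, mul_assoc]
  refine ⟨(Matrix.mem_orthogonalGroup_iff (Fin n) ℝ).2 ?_, ht, ?_⟩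
  · rw [ht, conj_mul_conj hU, mul_self_of_mem_Gr hS, mul_one, mul_transpose_of_mem hU]
  · rw [Matrix.trace_mul_comm, ← mul_assoc, transpose_mul_of_mem hU, one_mul, hS.2.2]

theorem exp_mem_orthogonalGroup {A : Matrix (Fin n) (Fin n) ℝ} (hA : Aᵀ = -A) :
    NormedSpace.exp A ∈ Matrix.orthogonalGroup (Fin n) ℝ := by
  rw [Matrix.mem_orthogonalGroup_iff, ← Matrix.exp_transpose, hA,
    ← Matrix.exp_add_of_commute _ _ (Commute.neg_right (Commute.refl A)), add_neg_cancel,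
    NormedSpace.exp_zero]

/-- The curve `V exp(tΩ)` in the orthogonal group. -/
def frame (V Ω : Matrix (Fin n) (Fin n) ℝ) (t : ℝ) : Matrix (Fin n) (Fin n) ℝ :=
  V * NormedSpace.exp (t • Ω)

/-- The curve of conjugates of `M` by the frame `V exp(tΩ)`. -/
def conjFrame (V Ω M : Matrix (Fin n) (Fin n) ℝ) (t : ℝ) : Matrix (Fin n) (Fin n) ℝ :=
  frame V Ω t * M * (frame V Ω t)ᵀ

variable {V Ω : Matrix (Fin n) (Fin n) ℝ}

theorem frame_mem (hV : V ∈ Matrix.orthogonalGroup (Fin n) ℝ) (hΩ : Ωᵀ = -Ω) (t : ℝ) :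
    frame V Ω t ∈ Matrix.orthogonalGroup (Fin n) ℝ :=
  mul_mem hV (exp_mem_orthogonalGroup (by rw [Matrix.transpose_smul, hΩ, smul_neg]))

theorem conjFrame_zero (M : Matrix (Fin n) (Fin n) ℝ) : conjFrame V Ω M 0 = V * M * Vᵀ := by
  simp [conjFrame, frame]

/-- The frame solves `U' = U Ω`, and skewness of `Ω` turns the two terms of the product rule into a
commutator. -/
theorem hasDerivAt_conjFrame (hΩ : Ωᵀ = -Ω) (M : Matrix (Fin n) (Fin n) ℝ) (t : ℝ) :
    HasDerivAt (conjFrame V Ω M) (conjFrame V Ω (Ω * M - M * Ω) t) t := by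
  have hU : HasDerivAt (frame V Ω) (frame V Ω t * Ω) t := by
    have := hasDerivAt_mul (hasDerivAt_const_matrix V t) (hasDerivAt_exp_smul Ω t)
    rw [zero_mul, zero_add, ← mul_assoc] at this
    exact this
  have h := hasDerivAt_mul (hasDerivAt_mul hU (hasDerivAt_const_matrix M t))
    (hasDerivAt_transpose hU)
  rw [Matrix.transpose_mul, hΩ] at h
  have e : conjFrame V Ω (Ω * M - M * Ω) t = ((frame V Ω t * Ω) * M + frame V Ω t * 0) *
      (frame V Ω t)ᵀ + frame V Ω t * M * (-Ω * (frame V Ω t)ᵀ) := by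
    simp only [conjFrame]
    noncomm_ring
  rw [e]
  exact h

theorem contDiff_conjFrame (M : Matrix (Fin n) (Fin n) ℝ) (i j : Fin n) :
    ContDiff ℝ ∞ (fun t => conjFrame V Ω M t i j) := by
  simp only [conjFrame, frame, Matrix.mul_apply, Matrix.transpose_apply]
  have := contDiff_exp_smul Ω
  fun_prop

/-! ### Tangent and normal spaces -/

/-- Differentiating `cᵀ = c` and `c² = 1` gives the two equations. Conversely, conjugating `Q` by
`exp(tXQ/2)` realises `X`; the trace adds no condition, being invariant under conjugation. -/
theorem mem_tangentSpace_iff {Q X : Matrix (Fin n) (Fin n) ℝ} (hQ : Q ∈ Gr k n) :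
    X ∈ tangentSpace k Q ↔ Xᵀ = X ∧ X * Q + Q * X = 0 := by
  constructor
  · rintro ⟨ε, c, hε, hc, -, rfl, hX⟩
    have h0 : (0 : ℝ) ∈ Set.Ioo (-ε) ε := by simp [hε]
    constructor
    · exact hasDerivAt_unique (hasDerivAt_congr isOpen_Ioo h0 (hasDerivAt_transpose hX)
        fun s hs => (hc s hs).2.1.symm) hX
    · exact hasDerivAt_unique (hasDerivAt_mul hX hX)
        (hasDerivAt_congr isOpen_Ioo h0 (hasDerivAt_const_matrix 1 0)
          fun s hs => mul_self_of_mem_Gr (hc s hs))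
  · rintro ⟨hs, ha⟩
    have hQX : Q * X = -(X * Q) := eq_neg_of_add_eq_zero_right ha
    have hΩ : ((1 / 2 : ℝ) • (X * Q))ᵀ = -((1 / 2 : ℝ) • (X * Q)) := by
      rw [Matrix.transpose_smul, Matrix.transpose_mul, hs, hQ.2.1, hQX, smul_neg]
    -- The factor `1/2` compensates for `(XQ)Q - Q(XQ) = 2X`.
    refine ⟨1, conjFrame 1 ((1 / 2 : ℝ) • (X * Q)) Q, one_pos,
      fun t _ => conj_mem_Gr (frame_mem (one_mem _) hΩ t) hQ,
      fun i j => (contDiff_conjFrame Q i j).contDiffOn, by simp [conjFrame_zero], ?_⟩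
    convert hasDerivAt_conjFrame hΩ Q 0
    rw [conjFrame_zero, Matrix.transpose_one, one_mul, mul_one, smul_mul_assoc, mul_smul_comm,
      ← mul_assoc Q, hQX, mul_assoc X, mul_self_of_mem_Gr hQ, neg_mul, mul_assoc X, mul_self_of_mem_Gr hQ, mul_one,
      ← smul_sub, sub_neg_eq_add, ← two_smul ℝ X, smul_smul]
    norm_num

theorem zero_mem_tangentSpace {Q : Matrix (Fin n) (Fin n) ℝ} (hQ : Q ∈ Gr k n) :
    0 ∈ tangentSpace k Q := by
  simp [mem_tangentSpace_iff hQ]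

/-- Conjugation by `Q` preserves the trace, fixes `W` and negates `T`, so `tr(TW) = -tr(TW)`. -/
theorem metric_eq_zero_of_commute {Q T W : Matrix (Fin n) (Fin n) ℝ} (hQ : Q ∈ Gr k n)
    (hT : T ∈ tangentSpace k Q) (hW : W * Q = Q * W) : metric T W = 0 := by
  obtain ⟨hs, ha⟩ := (mem_tangentSpace_iff hQ).1 hT
  have h : (T * W).trace = -(T * W).trace := by
    calc (T * W).trace = (T * W * (Q * Q)).trace := by rw [mul_self_of_mem_Gr hQ, mul_one]
      _ = (Q * T * (W * Q)).trace := by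
        rw [← mul_assoc, Matrix.trace_mul_comm]; simp only [mul_assoc]
      _ = -(T * W).trace := by
        rw [eq_neg_of_add_eq_zero_right ha, hW, neg_mul, Matrix.trace_neg, mul_assoc,
          ← mul_assoc Q, mul_self_of_mem_Gr hQ, one_mul]
  rw [metric, hs]
  linarith

theorem hasCovDerivAt_zero {γ Z : ℝ → Matrix (Fin n) (Fin n) ℝ} {W : Matrix (Fin n) (Fin n) ℝ}
    {t : ℝ} (hγ : γ t ∈ Gr k n) (hZ : HasDerivAt Z W t) (hW : W * γ t = γ t * W) :
    HasCovDerivAt k γ Z 0 t :=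
  ⟨W, hZ, zero_mem_tangentSpace hγ, fun T hT => by
    rw [sub_zero]; exact metric_eq_zero_of_commute hγ hT hW⟩

/-- A symmetric matrix orthogonal to the tangent space at `Q` commutes with `Q`. -/
theorem commute_of_metric_eq_zero {Q W : Matrix (Fin n) (Fin n) ℝ} (hQ : Q ∈ Gr k n)
    (hs : Wᵀ = W) (hW : ∀ T ∈ tangentSpace k Q, metric T W = 0) : W * Q = Q * W := by
  have hQQ := mul_self_of_mem_Gr hQ
  -- This is twice the tangential part of `W`; `W + QWQ` is twice the normal part.
  have hT : W - Q * W * Q ∈ tangentSpace k Q := by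
    rw [mem_tangentSpace_iff hQ]
    constructor
    · simp only [Matrix.transpose_sub, Matrix.transpose_mul, hs, hQ.2.1, mul_assoc]
    · rw [sub_mul, mul_sub, mul_assoc (Q * W), hQQ, mul_one, ← mul_assoc Q, ← mul_assoc Q, hQQ,
        one_mul]
      abel
  have h1 := hW _ hT
  have h2 : metric (W - Q * W * Q) (W + Q * W * Q) = 0 := by
    refine metric_eq_zero_of_commute hQ hT ?_
    rw [add_mul, mul_add, mul_assoc (Q * W), hQQ, mul_one, ← mul_assoc Q, ← mul_assoc Q, hQQ,
      one_mul, add_comm]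
  have h3 : metric (W - Q * W * Q) (W - Q * W * Q) = 0 := by
    have : metric (W - Q * W * Q) (W - Q * W * Q) =
        2 * metric (W - Q * W * Q) W - metric (W - Q * W * Q) (W + Q * W * Q) := by
      simp only [metric, mul_sub, mul_add, Matrix.trace_sub, Matrix.trace_add]
      ring
    rw [this, h1, h2]; simp
  have h4 := sub_eq_zero.1 (metric_self_eq_zero h3)
  calc W * Q = Q * W * Q * Q := by rw [← h4]
    _ = Q * W := by rw [mul_assoc, hQQ, mul_one]

/-! ### Uniqueness of geodesics and of parallel fields -/

/-- A geodesic is not assumed smooth, so its velocity is not tangent by definition; the equations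
come from differentiating the constraints along `γ`. -/
theorem IsGeodesicOn.deriv_mem {γ : ℝ → Matrix (Fin n) (Fin n) ℝ} {J : Set ℝ} (hJ : IsOpen J)
    (h : IsGeodesicOn k γ J) {t : ℝ} (ht : t ∈ J) :
    (deriv γ t)ᵀ = deriv γ t ∧ deriv γ t * γ t + γ t * deriv γ t = 0 := by
  have hd := hasDerivAt_deriv (h.differentiableAt t ht)
  exact ⟨hasDerivAt_unique (hasDerivAt_congr hJ ht (hasDerivAt_transpose hd)
      fun s hs => (h.mem s hs).2.1.symm) hd,
    hasDerivAt_unique (hasDerivAt_mul hd hd)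
      (hasDerivAt_congr hJ ht (hasDerivAt_const_matrix 1 t) fun s hs => mul_self_of_mem_Gr (h.mem s hs))⟩

/-- A geodesic `γ` solves the linear differential equation `γ' = X Q γ`. -/
theorem IsGeodesicFrom.hasDerivAt {γ : ℝ → Matrix (Fin n) (Fin n) ℝ} {J : Set ℝ}
    {Q X : Matrix (Fin n) (Fin n) ℝ} (hJ : IsOpen J) (hc : J.OrdConnected) (h0 : (0 : ℝ) ∈ J)
    (h : IsGeodesicFrom k γ J Q X) {t : ℝ} (ht : t ∈ J) :
    HasDerivAt γ (X * Q * γ t) t := by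
  have hg := h.isGeodesicOn
  -- Differentiating `γ'γ + γγ' = 0` gives `γ''γ + 2γ'² + γγ'' = 0`. As `γ''` commutes with `γ`,
  -- half of this is `(γ'γ)' = 0`.
  have hd : ∀ s ∈ J, HasDerivAt (fun s => deriv γ s * γ s - X * Q) 0 s := by
    intro s hs
    obtain ⟨W, hW, -, hT⟩ := hg.covDeriv s hs
    simp only [sub_zero] at hT
    have hd := hasDerivAt_deriv (hg.differentiableAt s hs)
    have hsymm : Wᵀ = W := hasDerivAt_unique (hasDerivAt_congr hJ hs (hasDerivAt_transpose hW)
      fun r hr => (hg.deriv_mem hJ hr).1.symm) hW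
    have hcomm := commute_of_metric_eq_zero (hg.mem s hs) hsymm hT
    have h2 := hasDerivAt_unique (hasDerivAt_add (hasDerivAt_mul hW hd) (hasDerivAt_mul hd hW))
      (hasDerivAt_congr hJ hs (hasDerivAt_const_matrix 0 s) fun r hr => (hg.deriv_mem hJ hr).2)
    rw [← hcomm, add_comm (deriv γ s * deriv γ s), ← two_smul ℝ] at h2
    have h3 := (smul_eq_zero.1 h2).resolve_left two_ne_zero
    have h4 := hasDerivAt_sub (hasDerivAt_mul hW hd) (hasDerivAt_const_matrix (X * Q) s)
    rwa [h3, sub_zero] at h4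
  have hX : deriv γ 0 = X :=
    hasDerivAt_unique (hasDerivAt_deriv (hg.differentiableAt 0 h0)) h.velocity
  have h1 := eq_zero_of_hasDerivAt_zero hJ hc h0 hd (by simp [hX, h.start]) t ht
  rw [← sub_eq_zero.1 h1, mul_assoc, mul_self_of_mem_Gr (hg.mem t ht), mul_one]
  exact hasDerivAt_deriv (hg.differentiableAt t ht)

/-- The difference solves `D' = (XQ)D` with `XQ` skew, so `⟨D, D'⟩ = 0`. -/
theorem IsGeodesicFrom.eqOn {γ η : ℝ → Matrix (Fin n) (Fin n) ℝ} {J : Set ℝ}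
    {Q X : Matrix (Fin n) (Fin n) ℝ} (hJ : IsOpen J) (hc : J.OrdConnected) (h0 : (0 : ℝ) ∈ J)
    (hγ : IsGeodesicFrom k γ J Q X) (hη : IsGeodesicFrom k η J Q X) :
    ∀ t ∈ J, γ t = η t := by
  have hQ : Q ∈ Gr k n := hγ.start ▸ hγ.isGeodesicOn.mem 0 h0
  obtain ⟨hs, ha⟩ : Xᵀ = X ∧ X * Q + Q * X = 0 := by
    have := hγ.isGeodesicOn.deriv_mem hJ h0
    rwa [hasDerivAt_unique (hasDerivAt_deriv (hγ.isGeodesicOn.differentiableAt 0 h0)) hγ.velocity,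
      hγ.start] at this
  have hskew : (X * Q)ᵀ = -(X * Q) := by
    rw [Matrix.transpose_mul, hs, hQ.2.1, eq_neg_of_add_eq_zero_right ha]
  have key := eq_zero_of_metric_deriv_eq_zero hJ hc h0
    (fun t ht => hasDerivAt_sub (hγ.hasDerivAt hJ hc h0 ht) (hη.hasDerivAt hJ hc h0 ht))
    (fun t _ => by
      rw [← mul_sub]
      have h1 := metric_comm (γ t - η t) (X * Q * (γ t - η t))
      have h2 : metric (X * Q * (γ t - η t)) (γ t - η t) =
          -metric (γ t - η t) (X * Q * (γ t - η t)) := by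
        rw [metric, metric, Matrix.transpose_mul, hskew, mul_neg, neg_mul, Matrix.trace_neg,
          mul_assoc]
      linarith) (by simp [hγ.start, hη.start])
  exact fun t ht => sub_eq_zero.1 (key t ht)

/-- The difference of two parallel fields is tangent while its derivative is normal. -/
theorem IsParallelTransport.eqOn {γ Z Z' : ℝ → Matrix (Fin n) (Fin n) ℝ} {J : Set ℝ}
    {Y : Matrix (Fin n) (Fin n) ℝ} (hJ : IsOpen J) (hc : J.OrdConnected) (h0 : (0 : ℝ) ∈ J)
    (hγ : ∀ t ∈ J, γ t ∈ Gr k n)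
    (hZ : IsParallelTransport k γ J Y Z) (hZ' : IsParallelTransport k γ J Y Z') :
    ∀ t ∈ J, Z t = Z' t := by
  choose! W hW _ hWT using hZ.covDeriv
  choose! W' hW' _ hWT' using hZ'.covDeriv
  have key := eq_zero_of_metric_deriv_eq_zero hJ hc h0
    (fun t ht => hasDerivAt_sub (hW t ht) (hW' t ht))
    (fun t ht => by
      have hT : Z t - Z' t ∈ tangentSpace k (γ t) := by
        have h1 := (mem_tangentSpace_iff (hγ t ht)).1 (hZ.tangent t ht)
        have h2 := (mem_tangentSpace_iff (hγ t ht)).1 (hZ'.tangent t ht)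
        refine (mem_tangentSpace_iff (hγ t ht)).2 ⟨by rw [Matrix.transpose_sub, h1.1, h2.1], ?_⟩
        rw [sub_mul, mul_sub, ← sub_eq_zero.2 (h1.2.trans h2.2.symm)]
        abel
      have h1 := hWT t ht _ hT
      have h2 := hWT' t ht _ hT
      rw [sub_zero] at h1 h2
      rw [metric, mul_sub, Matrix.trace_sub]
      simp only [metric] at h1 h2
      rw [h1, h2, sub_zero]) (by simp [hZ.start, hZ'.start])
  exact fun t ht => sub_eq_zero.1 (key t ht)

/-- Values outside `J` are arbitrary, but `J` is open, so derivatives at its points do not see them.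
-/
theorem IsParallelTransport.congr {γ η Z Z' : ℝ → Matrix (Fin n) (Fin n) ℝ} {J : Set ℝ}
    {Y : Matrix (Fin n) (Fin n) ℝ} (hJ : IsOpen J) (h0 : (0 : ℝ) ∈ J)
    (h : IsParallelTransport k γ J Y Z) (hγ : ∀ t ∈ J, η t = γ t) (hZ : ∀ t ∈ J, Z' t = Z t) :
    IsParallelTransport k η J Y Z' where
  tangent t ht := by rw [hγ t ht, hZ t ht]; exact h.tangent t ht
  covDeriv t ht := by
    obtain ⟨W, hW, hT⟩ := h.covDeriv t ht
    rw [← hγ t ht] at hT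
    exact ⟨W, hasDerivAt_congr hJ ht hW hZ, hT⟩
  start := by rw [hZ 0 h0, h.start]

/-! ### Explicit parallel fields and geodesics -/

theorem isParallelTransport_conjFrame {S M : Matrix (Fin n) (Fin n) ℝ}
    (hV : V ∈ Matrix.orthogonalGroup (Fin n) ℝ) (hΩ : Ωᵀ = -Ω) (hS : S ∈ Gr k n)
    (hΩS : S * Ω = -(Ω * S)) (hM : Mᵀ = M) (hMS : S * M = -(M * S)) (J : Set ℝ) :
    IsParallelTransport k (conjFrame V Ω S) J (V * M * Vᵀ) (conjFrame V Ω M) := by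
  have hU := frame_mem hV hΩ
  refine ⟨fun t _ => ?_, fun t _ => ?_, conjFrame_zero M⟩
  · rw [mem_tangentSpace_iff (Q := conjFrame V Ω S t) (conj_mem_Gr (hU t) hS)]
    simp only [conjFrame]
    refine ⟨by simp only [Matrix.transpose_mul, Matrix.transpose_transpose, hM, mul_assoc], ?_⟩
    rw [conj_mul_conj (hU t), conj_mul_conj (hU t), hMS, ← add_mul, ← mul_add, add_neg_cancel,
      mul_zero, zero_mul]
  · refine hasCovDerivAt_zero (conj_mem_Gr (hU t) hS) (hasDerivAt_conjFrame hΩ M t) ?_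
    simp only [conjFrame]
    rw [conj_mul_conj (hU t), conj_mul_conj (hU t)]
    -- Both `Ω` and `M` anticommute with `S`, so their products commute with it.
    congr 2
    rw [sub_mul, mul_sub, ← mul_assoc, ← mul_assoc, hΩS, hMS, neg_mul, neg_mul, mul_assoc Ω S M,
      mul_assoc M S Ω, hΩS, hMS, mul_neg, mul_neg, neg_neg, neg_neg]
    simp only [mul_assoc]

theorem isGeodesicFrom_conjFrame {S : Matrix (Fin n) (Fin n) ℝ}
    (hV : V ∈ Matrix.orthogonalGroup (Fin n) ℝ) (hΩ : Ωᵀ = -Ω) (hS : S ∈ Gr k n)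
    (hΩS : S * Ω = -(Ω * S)) (J : Set ℝ) :
    IsGeodesicFrom k (conjFrame V Ω S) J (V * S * Vᵀ) (V * (Ω * S - S * Ω) * Vᵀ) := by
  have hd : deriv (conjFrame V Ω S) = conjFrame V Ω (Ω * S - S * Ω) := funext fun t =>
    hasDerivAt_unique (hasDerivAt_deriv (differentiableAt_of_hasDerivAt (hasDerivAt_conjFrame hΩ S t)))
      (hasDerivAt_conjFrame hΩ S t)
  refine ⟨⟨fun t _ => conj_mem_Gr (frame_mem hV hΩ t) hS,
    fun t _ => differentiableAt_of_hasDerivAt (hasDerivAt_conjFrame hΩ S t), ?_⟩, conjFrame_zero S, ?_⟩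
  · rw [hd]
    -- The velocity is the parallel field with `M = ΩS - SΩ`, which is symmetric and anticommutes
    -- with `S`.
    refine (isParallelTransport_conjFrame hV hΩ hS hΩS ?_ ?_ J).covDeriv
    · rw [Matrix.transpose_sub, Matrix.transpose_mul, Matrix.transpose_mul, hΩ, hS.2.1]
      noncomm_ring
    · rw [mul_sub, sub_mul, ← mul_assoc, ← mul_assoc, hΩS]
      simp only [mul_assoc, neg_mul, mul_self_of_mem_Gr hS]
      simp only [one_mul, mul_one]
      noncomm_ring
  · rw [← conjFrame_zero (Ω := Ω)]
    exact hasDerivAt_conjFrame hΩ S 0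

/-! ### Block matrices -/

theorem block_mul (hk : k ≤ n) (A₁₁ : Matrix (Fin k) (Fin k) ℝ)
    (A₁₂ : Matrix (Fin k) (Fin (n - k)) ℝ) (A₂₁ : Matrix (Fin (n - k)) (Fin k) ℝ)
    (A₂₂ : Matrix (Fin (n - k)) (Fin (n - k)) ℝ) (B₁₁ : Matrix (Fin k) (Fin k) ℝ)
    (B₁₂ : Matrix (Fin k) (Fin (n - k)) ℝ) (B₂₁ : Matrix (Fin (n - k)) (Fin k) ℝ)
    (B₂₂ : Matrix (Fin (n - k)) (Fin (n - k)) ℝ) :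
    block hk A₁₁ A₁₂ A₂₁ A₂₂ * block hk B₁₁ B₁₂ B₂₁ B₂₂ =
      block hk (A₁₁ * B₁₁ + A₁₂ * B₂₁) (A₁₁ * B₁₂ + A₁₂ * B₂₂)
        (A₂₁ * B₁₁ + A₂₂ * B₂₁) (A₂₁ * B₁₂ + A₂₂ * B₂₂) := by
  simp only [block, Matrix.reindex_apply, Matrix.submatrix_mul_equiv, Matrix.fromBlocks_multiply]

theorem block_transpose (hk : k ≤ n) (A₁₁ : Matrix (Fin k) (Fin k) ℝ)
    (A₁₂ : Matrix (Fin k) (Fin (n - k)) ℝ) (A₂₁ : Matrix (Fin (n - k)) (Fin k) ℝ)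
    (A₂₂ : Matrix (Fin (n - k)) (Fin (n - k)) ℝ) :
    (block hk A₁₁ A₁₂ A₂₁ A₂₂)ᵀ = block hk A₁₁ᵀ A₂₁ᵀ A₁₂ᵀ A₂₂ᵀ := by
  simp only [block, Matrix.reindex_apply, Matrix.transpose_submatrix,
    Matrix.fromBlocks_transpose]

theorem block_neg (hk : k ≤ n) (A₁₁ : Matrix (Fin k) (Fin k) ℝ)
    (A₁₂ : Matrix (Fin k) (Fin (n - k)) ℝ) (A₂₁ : Matrix (Fin (n - k)) (Fin k) ℝ)
    (A₂₂ : Matrix (Fin (n - k)) (Fin (n - k)) ℝ) :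
    -block hk A₁₁ A₁₂ A₂₁ A₂₂ = block hk (-A₁₁) (-A₁₂) (-A₂₁) (-A₂₂) := by
  simp only [block, Matrix.reindex_apply, ← Matrix.fromBlocks_neg]
  rfl

theorem block_trace (hk : k ≤ n) (A₁₁ : Matrix (Fin k) (Fin k) ℝ)
    (A₁₂ : Matrix (Fin k) (Fin (n - k)) ℝ) (A₂₁ : Matrix (Fin (n - k)) (Fin k) ℝ)
    (A₂₂ : Matrix (Fin (n - k)) (Fin (n - k)) ℝ) :
    (block hk A₁₁ A₁₂ A₂₁ A₂₂).trace = A₁₁.trace + A₂₂.trace := by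
  have h : (block hk A₁₁ A₁₂ A₂₁ A₂₂).trace = (Matrix.fromBlocks A₁₁ A₁₂ A₂₁ A₂₂).trace :=
    Equiv.sum_comp (finSumFinEquiv.trans (finCongr (Nat.add_sub_of_le hk))).symm
      fun i => Matrix.fromBlocks A₁₁ A₁₂ A₂₁ A₂₂ i i
  rw [h]
  simp [Matrix.trace, Fintype.sum_sum_type]

theorem signature_mem_Gr (hk : k ≤ n) : signature hk ∈ Gr k n := by
  have ht : (signature hk)ᵀ = signature hk := by simp [signature, block_transpose]
  refine ⟨(Matrix.mem_orthogonalGroup_iff (Fin n) ℝ).2 ?_, ht, ?_⟩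
  · rw [ht]
    simp only [signature, block_mul, Matrix.mul_zero, Matrix.zero_mul, mul_one, neg_mul_neg,
      add_zero, zero_add]
    rw [block, Matrix.fromBlocks_one, Matrix.reindex_apply,
      Matrix.submatrix_one_equiv]
  · simp [signature, block_trace, Nat.cast_sub hk]
    ring

/-- No relation between `A` and `A'` is imposed, so this serves both the skew generator and the
symmetric block of `C`. -/
theorem signature_mul_block (hk : k ≤ n) (A : Matrix (Fin k) (Fin (n - k)) ℝ)
    (A' : Matrix (Fin (n - k)) (Fin k) ℝ) :
    signature hk * block hk 0 A A' 0 = -(block hk 0 A A' 0 * signature hk) := by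
  simp [signature, block_mul, block_neg]

end InvolutionModel

end

/-! ### Parallel transport in block form -/

open InvolutionModel in
theorem proposition4p7 {n k : ℕ} (hk : k ≤ n)
    (V Q X Y : Matrix (Fin n) (Fin n) ℝ) (B C : Matrix (Fin k) (Fin (n - k)) ℝ)
    (hV : V ∈ Matrix.orthogonalGroup (Fin n) ℝ)
    (hQ : Q = V * InvolutionModel.signature hk * Vᵀ)
    (hX : X = V * InvolutionModel.block hk 0 B Bᵀ 0 * Vᵀ)
    (hY : Y = V * InvolutionModel.block hk 0 C Cᵀ 0 * Vᵀ) :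
    -- a geodesic from `Q` in the direction `X` exists for all times
    (∃ γ : ℝ → Matrix (Fin n) (Fin n) ℝ,
      InvolutionModel.IsGeodesicFrom k γ Set.univ Q X) ∧
    ∀ (J : Set ℝ) (_ : IsOpen J) (_ : J.OrdConnected) (_ : (0 : ℝ) ∈ J)
      (γ : ℝ → Matrix (Fin n) (Fin n) ℝ) (_ : InvolutionModel.IsGeodesicFrom k γ J Q X),
      -- the parallel transport of `Y` along `γ` exists, is unique and is given by the formula
      (∀ Z : ℝ → Matrix (Fin n) (Fin n) ℝ,
        InvolutionModel.IsParallelTransport k γ J Y Z ↔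
          ∀ t ∈ J, Z t =
            V * NormedSpace.exp ((t / 2) • InvolutionModel.block hk 0 (-B) Bᵀ 0)
              * InvolutionModel.block hk 0 C Cᵀ 0
              * NormedSpace.exp ((t / 2) • InvolutionModel.block hk 0 B (-Bᵀ) 0) * Vᵀ) ∧
      -- in the eigenbasis `U` of `γ t` obtained by moving `V`, its block is `C` for all `t`
      ∀ t ∈ J, ∀ U : Matrix (Fin n) (Fin n) ℝ,
        U = V * NormedSpace.exp ((t / 2) • InvolutionModel.block hk 0 (-B) Bᵀ 0) →
          U ∈ Matrix.orthogonalGroup (Fin n) ℝ ∧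
          γ t = U * InvolutionModel.signature hk * Uᵀ ∧
          ∀ Z : ℝ → Matrix (Fin n) (Fin n) ℝ,
            InvolutionModel.IsParallelTransport k γ J Y Z →
              Z t = U * InvolutionModel.block hk 0 C Cᵀ 0 * Uᵀ := by
  set N := block hk 0 (-B) Bᵀ 0 with hN
  have hS := signature_mem_Gr hk
  have hNt : Nᵀ = -N := by simp [hN, block_transpose, block_neg]
  have hΩ : ((1 / 2 : ℝ) • N)ᵀ = -((1 / 2 : ℝ) • N) := by
    rw [Matrix.transpose_smul, hNt, smul_neg]
  have hSN : signature hk * N = -(N * signature hk) := signature_mul_block hk _ _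
  have hΩS : signature hk * ((1 / 2 : ℝ) • N) = -(((1 / 2 : ℝ) • N) * signature hk) := by
    rw [mul_smul_comm, smul_mul_assoc, hSN, smul_neg]
  -- With `Ω = N/2` anticommuting with the signature `S`, the bracket `ΩS - SΩ` is `2ΩS = NS`; hence
  -- the `t/2` in the exponentials.
  have hvel : ((1 / 2 : ℝ) • N) * signature hk - signature hk * ((1 / 2 : ℝ) • N) =
      block hk 0 B Bᵀ 0 := by
    rw [hΩS, sub_neg_eq_add, smul_mul_assoc, ← two_smul ℝ, smul_smul]
    norm_num [hN, signature, block_mul]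
  have hgeo := isGeodesicFrom_conjFrame hV hΩ hS hΩS
  rw [hvel, ← hQ, ← hX] at hgeo
  have hpar := isParallelTransport_conjFrame (M := block hk 0 C Cᵀ 0) hV hΩ hS hΩS
    (by simp [block_transpose]) (signature_mul_block hk _ _)
  rw [← hY] at hpar
  have hframe : ∀ t : ℝ, V * NormedSpace.exp ((t / 2) • N) = frame V ((1 / 2 : ℝ) • N) t := by
    intro t
    rw [frame, smul_smul, mul_one_div]
  have hformula : ∀ t : ℝ, V * NormedSpace.exp ((t / 2) • N) * block hk 0 C Cᵀ 0
      * NormedSpace.exp ((t / 2) • block hk 0 B (-Bᵀ) 0) * Vᵀ =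
        conjFrame V ((1 / 2 : ℝ) • N) (block hk 0 C Cᵀ 0) t := by
    intro t
    -- The right-hand exponential is the transpose of the left-hand one.
    have hN' : block hk 0 B (-Bᵀ) 0 = Nᵀ := by simp [hN, block_transpose]
    rw [conjFrame, ← hframe, Matrix.transpose_mul, ← Matrix.exp_transpose,
      Matrix.transpose_smul, hN']
    simp only [mul_assoc]
  refine ⟨⟨_, hgeo Set.univ⟩, fun J hJ hc h0 γ hγ => ?_⟩
  have hγeq := hγ.eqOn hJ hc h0 (hgeo J)
  have hparγ := fun (Z : ℝ → Matrix (Fin n) (Fin n) ℝ)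
      (hZ : ∀ t ∈ J, Z t = conjFrame V ((1 / 2 : ℝ) • N) (block hk 0 C Cᵀ 0) t) =>
    (hpar J).congr hJ h0 hγeq hZ
  have huniq := fun Z (hZ : IsParallelTransport k γ J Y Z) =>
    hZ.eqOn hJ hc h0 hγ.isGeodesicOn.mem (hparγ _ fun _ _ => rfl)
  simp only [hformula]
  refine ⟨fun Z => ⟨huniq Z, hparγ Z⟩, ?_⟩
  rintro t ht U rfl
  rw [hframe]
  exact ⟨frame_mem hV hΩ t, hγeq t ht, fun Z hZ => huniq Z hZ t ht⟩
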